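/- Let $p$ be a prime number. For a number field $k$ let $L_p(k)$ be the compositum, inside an algebraic closure of $k$, of all finite Galois extensions of $k$ of $p$-power degree that are unramified at every prime and at every infinite place of $k$. Put $G_k=\mathrm{Gal}(L_p(k)/k)$, a profinite group, and $h^i(G_k)=\dim_{\mathbb{F}_p}H^i(G_k,\mathbb{Z}/p)$ (continuous cohomology, trivial action). Let $r_1(k)$ and $r_2(k)$ be the numbers of real and complex places of $k$, let $\mu_p$ be the group of $p$-th roots of unity, and set $$f(k)=\begin{cases} r_1(k)+r_2(k)-h^2(G_k)+h^1(G_k)-1 & \text{if } \mu_p\not\subset k,\\ r_1(k)+r_2(k)-h^2(G_k) & \text{if } \mu_p\subset k.\end{cases}$$ **Proposition.** Let $k'/k$ be a Galois extension of number fields with $\mathrm{Gal}(k'/k)\cong\mathbb{Z}/p$ that is at most tamely ramified at the finite primes and unramified at the infinite places. Write $G=G_k$ and $G'=G_{k'}$, and suppose that there is a short exact sequence of profinite groups (with continuous homomorphisms) $$1\to\mathbb{Z}/p\to G'\to G\to 1.$$ Then $$f(k)\ge 2h^1(G)+3\quad\Longrightarrow\quad f(k')\ge 2h^1(G')+3.$$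 -/

import Mathlib

open NumberField

/-- An extension `F / k` of number fields is unramified if it is unramified at every prime of
`𝓞 F` and at every infinite place. -/
def IsEverywhereUnramified (k F : Type*) [Field k] [Field F] [Algebra k F] : Prop :=
  (∀ (P : Ideal (𝓞 F)) [P.IsPrime], Algebra.IsUnramifiedAt (𝓞 k) P) ∧
    IsUnramifiedAtInfinitePlaces k F

/-- `F / k` is at most tamely ramified: at every nonzero prime `P` of `𝓞 F` the ramification
index is prime to the residue characteristic, and no infinite place ramifies. (The residue fields
are finite, so the residue extensions are separable.) -/
def IsTamelyRamifiedExt (k F : Type*) [Field k] [Field F] [Algebra k F] : Prop :=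
  (∀ (P : Ideal (𝓞 F)), P.IsPrime → P ≠ ⊥ →
    (P.ramificationIdx (𝓞 k)).Coprime (ringChar (𝓞 F ⧸ P))) ∧
    IsUnramifiedAtInfinitePlaces k F

/-- The top `L_p(k)` of the `p`-Hilbert class field tower of `k`: the compositum, inside an
algebraic closure of `k`, of all finite Galois extensions of `k` that are unramified everywhere
and whose degree is a power of `p`. -/
noncomputable def hilbertTower (p : ℕ) (k : Type*) [Field k] :
    IntermediateField k (AlgebraicClosure k) :=
  sSup {F | FiniteDimensional k F ∧ IsGalois k F ∧ (∃ n : ℕ, Module.finrank k F = p ^ n) ∧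
    IsEverywhereUnramified k F}

/-- The `p`-class tower group `Gal(L_p(k) / k)`, with its Krull topology. -/
abbrev towerGroup (p : ℕ) (k : Type*) [Field k] : Type _ :=
  Gal(hilbertTower p k/k)

instance continuousSMulULiftZMod.{u} (p : ℕ) :
    ContinuousSMul (ZMod p) (ULift.{u} (ZMod p)) :=
  ⟨continuous_of_discreteTopology⟩

/-- `h^i(G) = dim H^i(G, ℤ/p)`, the dimension over `ℤ/p` of continuous cohomology with
coefficients in the discrete trivial module `ℤ/p` (lifted to the universe of `G`). -/
noncomputable def cohDim.{u} (p i : ℕ) (G : Type u) [Group G] [TopologicalSpace G]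
    [IsTopologicalGroup G] : ℕ :=
  Module.finrank (ZMod p)
    (continuousCohomology i
      (TopRep.of (ContRepresentation.trivial (ZMod p) G (ULift.{u} (ZMod p)))))

/-- `μ_p ⊂ k`. -/
def ContainsMu (p : ℕ) (k : Type*) [Field k] : Prop :=
  ∃ ζ : k, IsPrimitiveRoot ζ p

open scoped Classical in
/-- The invariant `f(k)`, an integer: with `G = Gal(L_p(k) / k)`, it is
`r₁ + r₂ - h²(G) + h¹(G) - 1` if `μ_p ⊄ k` and `r₁ + r₂ - h²(G)` if `μ_p ⊂ k`. -/
noncomputable def fInv (p : ℕ) (k : Type*) [Field k] [NumberField k] : ℤ :=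
  if ContainsMu p k then
    (InfinitePlace.nrRealPlaces k : ℤ) + InfinitePlace.nrComplexPlaces k
      - cohDim p 2 (towerGroup p k)
  else
    (InfinitePlace.nrRealPlaces k : ℤ) + InfinitePlace.nrComplexPlaces k
      - cohDim p 2 (towerGroup p k) + cohDim p 1 (towerGroup p k) - 1

/-! Write r = r₁ + r₂, hⁱ = hⁱ(G), and add primes for k'. Since no infinite place ramifies, r' = p·r
≥ 2r, and μ_p ⊂ k' exactly when μ_p ⊂ k, because an element of degree at most p - 1 cannot generate
an extension of degree p. It therefore suffices to bound the cohomology of G' by that of G: h¹(G') ≤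
h¹ + 1 and h²(G') ≤ h² + h¹ + 1. Both bounds come from the low-degree filtration of a central
extension of G by ℤ/p, made explicit with cocycles (`finrank_contHom_le`, `finrank_contH₂_le`).
Centrality holds because G' is pro-p and Aut(ℤ/p) has order p - 1 (`GroupExtension.inl_comm`). A
continuous equivariant map G' → ℤ/p replaces the choice of a continuous section
(`GroupExtension.exists_isCentralZModExtension`).

The dimensions are `finrank`s, which are 0 for infinite-dimensional spaces. Finiteness of H¹(G) is
thus needed, and follows from Hermite's theorem (`finite_contHom_towerGroup`). Finiteness of H²(G)
is not needed: if it fails for G, it fails for G', and the bound becomes trivial. -/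

/-! ### Homology of topological complexes and inhomogeneous cochains. -/

section ContinuousCochains

open CategoryTheory TopRep

/-- Homology of a complex of topological modules, computed through an injective linear map that
identifies cycles and boundaries with explicit submodules. -/
theorem finrank_topModule_homology {R : Type*} [Ring R] [TopologicalSpace R]
    (K : CochainComplex (TopModuleCat R) ℕ) (i : ℕ) {V : Type*} [AddCommGroup V] [Module R V]
    (φ : K.X (i + 1) →ₗ[R] V) (hφ : Function.Injective φ) (Z B : Submodule R V)
    (hZ : ∀ v, v ∈ Z ↔ ∃ x, (K.d (i + 1) (i + 2)).hom x = 0 ∧ φ x = v)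
    (hB : ∀ v, v ∈ B ↔ ∃ y, φ ((K.d i (i + 1)).hom y) = v) :
    Module.finrank R (K.homology (i + 1)) = Module.finrank R (Z ⧸ B.comap Z.subtype) := by
  let S := K.sc' i (i + 1) (i + 2)
  let D : S.LeftHomologyData :=
    ⟨_, _, _, _, _, TopModuleCat.isLimitKer _, by simp, TopModuleCat.isColimitCoker _⟩
  let e : K.homology (i + 1) ≅ D.H :=
    K.homologyIsoSc' i (i + 1) (i + 2) (by simp) (by simp) ≪≫ D.homologyIso
  let f' : S.X₁ ⟶ TopModuleCat.ker S.g := D.f'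
  have hf' (y) : (f'.hom y).1 = S.f.hom y := by
    have h := ConcreteCategory.congr_hom D.f'_i y
    exact h
  let e₁ : (S.g.hom.ker ⧸ f'.hom.range) ≃ₗ[R] D.H := LinearEquiv.refl _ _
  let ψ : S.g.hom.ker →ₗ[R] Z := LinearMap.codRestrict Z (φ ∘ₗ Submodule.subtype _)
    fun x ↦ (hZ _).2 ⟨x.1, x.2, rfl⟩
  have hψ : Function.Bijective ψ := by
    refine ⟨fun x y h ↦ Subtype.ext (hφ (congrArg Subtype.val h)), fun ⟨v, hv⟩ ↦ ?_⟩
    obtain ⟨x, hx, rfl⟩ := (hZ v).1 hv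
    exact ⟨⟨x, hx⟩, rfl⟩
  let e₂ : (S.g.hom.ker ⧸ f'.hom.range) ≃ₗ[R] Z ⧸ B.comap Z.subtype := by
    refine Submodule.Quotient.equiv _ _ (LinearEquiv.ofBijective ψ hψ) ?_
    ext ⟨v, hv⟩
    simp only [Submodule.mem_map, Submodule.mem_comap, Submodule.subtype_apply, hB]
    constructor
    · rintro ⟨_, ⟨y, rfl⟩, h⟩
      exact ⟨y, (congrArg φ (hf' y)).symm.trans (congrArg Subtype.val h)⟩
    · rintro ⟨y, hy⟩
      exact ⟨f'.hom y, ⟨y, rfl⟩, Subtype.ext ((congrArg φ (hf' y)).trans hy)⟩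
  exact (e.toContinuousLinearEquiv.toLinearEquiv.trans (e₁.symm.trans e₂)).finrank_eq

variable (p : ℕ) (Γ : Type*) [Group Γ] [TopologicalSpace Γ]

/-- Continuous homomorphisms to `ZMod p`. -/
def contHom : Submodule (ZMod p) (Γ → ZMod p) where
  carrier := {f | Continuous f ∧ ∀ g h, f (g * h) = f g + f h}
  zero_mem' := ⟨continuous_const, by simp⟩
  add_mem' := fun ⟨h₁, h₂⟩ ⟨h₃, h₄⟩ ↦ ⟨h₁.add h₃, fun g h ↦ by simp [h₂, h₄]; ring⟩
  smul_mem' := fun a _ ⟨h₁, h₂⟩ ↦ ⟨h₁.const_smul a, fun g h ↦ by simp [h₂, mul_add]⟩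

/-- Continuous functions to `ZMod p`. -/
def contFun : Submodule (ZMod p) (Γ → ZMod p) where
  carrier := {f | Continuous f}
  zero_mem' := continuous_const
  add_mem' := fun h₁ h₃ ↦ h₁.add h₃
  smul_mem' := fun a _ h₁ ↦ h₁.const_smul a

/-- Continuous inhomogeneous 2-cocycles. -/
def contCocycle₂ : Submodule (ZMod p) (Γ → Γ → ZMod p) where
  carrier := {c | Continuous (fun x : Γ × Γ ↦ c x.1 x.2) ∧
    ∀ g h k, c g h + c (g * h) k = c g (h * k) + c h k}
  zero_mem' := ⟨continuous_const, by simp⟩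
  add_mem' := fun {a b} ⟨h₁, h₂⟩ ⟨h₃, h₄⟩ ↦ ⟨h₁.add h₃, fun g h k ↦ by
    simp only [Pi.add_apply]; linear_combination h₂ g h k + h₄ g h k⟩
  smul_mem' := fun a _ ⟨h₁, h₂⟩ ↦ ⟨h₁.const_smul a, fun g h k ↦ by
    simp only [Pi.smul_apply, smul_eq_mul]; linear_combination a * h₂ g h k⟩

/-- The coboundary of a 1-cochain. -/
def coboundary₂ : (Γ → ZMod p) →ₗ[ZMod p] (Γ → Γ → ZMod p) where
  toFun b g h := b h - b (g * h) + b g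
  map_add' _ _ := by ext; simp; ring
  map_smul' _ _ := by ext; simp; ring

/-- Second continuous cohomology with coefficients in `ZMod p`, by inhomogeneous cochains. -/
abbrev contH₂ : Type _ :=
  contCocycle₂ p Γ ⧸ ((contFun p Γ).map (coboundary₂ p Γ)).comap (contCocycle₂ p Γ).subtype

end ContinuousCochains

/-! ### Comparison of homogeneous and inhomogeneous cohomology in degrees 1 and 2. -/

section LowDegree

open TopRep

universe u

variable (p : ℕ) (Γ : Type u) [Group Γ] [TopologicalSpace Γ] [IsTopologicalGroup Γ]

/-- The trivial representation of `Γ` on `ZMod p`. -/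
noncomputable abbrev trivRep : TopRep (ZMod p) Γ :=
  TopRep.of (ContRepresentation.trivial (ZMod p) Γ (ULift.{u} (ZMod p)))

variable {p Γ}

theorem trivRep_cochain_invariant₁ (σ : (homogeneousCochains (trivRep p Γ)).X 0) (g x : Γ) :
    σ.1 (g * x) = σ.1 x := by
  have h := congrArg (fun f : C(Γ, ULift (ZMod p)) => f x) (σ.2 g⁻¹)
  change σ.1 (g⁻¹⁻¹ * x) = σ.1 x at h
  simpa using h

theorem trivRep_cochain_invariant₂ (σ : (homogeneousCochains (trivRep p Γ)).X 1) (g x y : Γ) :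
    σ.1 (g * x) (g * y) = σ.1 x y := by
  have h := congrArg (fun f : C(Γ, C(Γ, ULift (ZMod p))) => f x y) (σ.2 g⁻¹)
  change σ.1 (g⁻¹⁻¹ * x) (g⁻¹⁻¹ * y) = σ.1 x y at h
  simpa using h

theorem trivRep_cochain_invariant₃ (σ : (homogeneousCochains (trivRep p Γ)).X 2) (g x y z : Γ) :
    σ.1 (g * x) (g * y) (g * z) = σ.1 x y z := by
  have h := congrArg (fun f : C(Γ, C(Γ, C(Γ, ULift (ZMod p)))) => f x y z) (σ.2 g⁻¹)
  change σ.1 (g⁻¹⁻¹ * x) (g⁻¹⁻¹ * y) (g⁻¹⁻¹ * z) = σ.1 x y z at h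
  simpa using h

theorem trivRep_d_apply₁ (σ : (homogeneousCochains (trivRep p Γ)).X 0) (x y : Γ) :
    (((homogeneousCochains (trivRep p Γ)).d 0 1).hom σ).1 x y = σ.1 y - σ.1 x :=
  congrArg (fun f : C(Γ, C(Γ, ULift (ZMod p))) => f x y)
    (homogeneousCochains.d_apply (trivRep p Γ) 0 σ)

theorem trivRep_d_apply₂ (σ : (homogeneousCochains (trivRep p Γ)).X 1) (x y z : Γ) :
    (((homogeneousCochains (trivRep p Γ)).d 1 2).hom σ).1 x y z =
      σ.1 y z - (σ.1 x z - σ.1 x y) :=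
  congrArg (fun f : C(Γ, C(Γ, C(Γ, ULift (ZMod p)))) => f x y z)
    (homogeneousCochains.d_apply (trivRep p Γ) 1 σ)

theorem trivRep_d_apply₃ (σ : (homogeneousCochains (trivRep p Γ)).X 2) (x y z w : Γ) :
    (((homogeneousCochains (trivRep p Γ)).d 2 3).hom σ).1 x y z w =
      σ.1 y z w - (σ.1 x z w - (σ.1 x y w - σ.1 x y z)) :=
  congrArg (fun f : C(Γ, C(Γ, C(Γ, C(Γ, ULift (ZMod p))))) => f x y z w)
    (homogeneousCochains.d_apply (trivRep p Γ) 2 σ)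

theorem trivRep_d_eq_zero₂ {σ : (homogeneousCochains (trivRep p Γ)).X 1} :
    ((homogeneousCochains (trivRep p Γ)).d 1 2).hom σ = 0 ↔
      ∀ x y z, σ.1 y z - (σ.1 x z - σ.1 x y) = 0 := by
  refine ⟨fun h x y z ↦ ?_, fun h ↦ Subtype.ext ?_⟩
  · rw [← trivRep_d_apply₂, h]; rfl
  · refine ContinuousMap.ext fun x ↦ ContinuousMap.ext fun y ↦ ContinuousMap.ext fun z ↦ ?_
    exact (trivRep_d_apply₂ σ x y z).trans (h x y z)

theorem trivRep_d_eq_zero₃ {σ : (homogeneousCochains (trivRep p Γ)).X 2} :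
    ((homogeneousCochains (trivRep p Γ)).d 2 3).hom σ = 0 ↔
      ∀ x y z w, σ.1 y z w - (σ.1 x z w - (σ.1 x y w - σ.1 x y z)) = 0 := by
  refine ⟨fun h x y z w ↦ ?_, fun h ↦ Subtype.ext ?_⟩
  · rw [← trivRep_d_apply₃, h]; rfl
  · refine ContinuousMap.ext fun x ↦ ContinuousMap.ext fun y ↦ ContinuousMap.ext fun z ↦
      ContinuousMap.ext fun w ↦ ?_
    exact (trivRep_d_apply₃ σ x y z w).trans (h x y z w)

/-- The homogeneous 1-cochain of a continuous function. -/
noncomputable def homogeneousOfFun₁ (b : Γ → ZMod p) (hb : Continuous b) :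
    (homogeneousCochains (trivRep p Γ)).X 1 :=
  ⟨(⟨fun x : Γ × Γ ↦ ULift.up (b (x.1⁻¹ * x.2)),
      continuous_uliftUp.comp (hb.comp (by fun_prop))⟩ : C(Γ × Γ, ULift (ZMod p))).curry, fun g ↦ by
    refine ContinuousMap.ext fun x ↦ ContinuousMap.ext fun y ↦ ?_
    change ULift.up (b ((g⁻¹ * x)⁻¹ * (g⁻¹ * y))) = ULift.up (b (x⁻¹ * y))
    congr 2; group⟩

/-- The homogeneous 2-cochain of a continuous function of two variables. -/
noncomputable def homogeneousOfFun₂ (c : Γ → Γ → ZMod p)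
    (hc : Continuous fun x : Γ × Γ ↦ c x.1 x.2) :
    (homogeneousCochains (trivRep p Γ)).X 2 :=
  ⟨(⟨fun x : (Γ × Γ) × Γ ↦ ULift.up (c (x.1.1⁻¹ * x.1.2) (x.1.2⁻¹ * x.2)),
      continuous_uliftUp.comp (hc.comp (f := fun x : (Γ × Γ) × Γ ↦
        (x.1.1⁻¹ * x.1.2, x.1.2⁻¹ * x.2)) (by fun_prop))⟩ :
        C((Γ × Γ) × Γ, ULift (ZMod p))).curry.curry, fun g ↦ by
    refine ContinuousMap.ext fun x ↦ ContinuousMap.ext fun y ↦ ContinuousMap.ext fun z ↦ ?_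
    change ULift.up (c ((g⁻¹ * x)⁻¹ * (g⁻¹ * y)) ((g⁻¹ * y)⁻¹ * (g⁻¹ * z))) =
      ULift.up (c (x⁻¹ * y) (y⁻¹ * z))
    congr 2 <;> group⟩

variable (p Γ)

/-- By invariance a homogeneous cochain is determined by g ↦ σ(1, g). Degree-one coboundaries vanish
because the action is trivial, so nothing is divided out. -/
theorem cohDim_one_eq : cohDim p 1 Γ = Module.finrank (ZMod p) (contHom p Γ) := by
  let φ : (homogeneousCochains (trivRep p Γ)).X 1 →ₗ[ZMod p] (Γ → ZMod p) :=
    { toFun σ g := (σ.1 1 g).down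
      map_add' _ _ := rfl
      map_smul' _ _ := rfl }
  have hφ (σ) (g : Γ) : ULift.up (φ σ g) = σ.1 1 g := rfl
  have key := finrank_topModule_homology (homogeneousCochains (trivRep p Γ)) 0 φ ?_ (contHom p Γ) ⊥
    (fun f ↦ ?_) (fun f ↦ ?_)
  · refine key.trans (LinearEquiv.finrank_eq (Submodule.quotEquivOfEqBot _ ?_))
    rw [Submodule.comap_bot, Submodule.ker_subtype]
  · intro σ τ h
    refine Subtype.ext (ContinuousMap.ext fun x ↦ ContinuousMap.ext fun y ↦ ?_)
    rw [← trivRep_cochain_invariant₂ σ x⁻¹, ← trivRep_cochain_invariant₂ τ x⁻¹, inv_mul_cancel,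
      ← hφ, ← hφ, h]
  · constructor
    · rintro ⟨hf, hm⟩
      refine ⟨homogeneousOfFun₁ f hf, trivRep_d_eq_zero₂.2 fun x y z ↦ ?_, funext fun g ↦ ?_⟩
      · have := hm (x⁻¹ * y) (y⁻¹ * z)
        rw [show x⁻¹ * y * (y⁻¹ * z) = x⁻¹ * z by group] at this
        exact congrArg ULift.up (by rw [this]; ring : f (y⁻¹ * z) - (f (x⁻¹ * z) - f (x⁻¹ * y)) = 0)
      · change f (1⁻¹ * g) = f g
        simp
    · rintro ⟨σ, h, rfl⟩
      refine ⟨continuous_uliftDown.comp (σ.1 1).continuous, fun g k ↦ ?_⟩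
      have h1 := trivRep_d_eq_zero₂.1 h 1 g (g * k)
      have h2 := trivRep_cochain_invariant₂ σ g 1 k
      rw [mul_one] at h2
      rw [h2] at h1
      have h3 := congrArg ULift.down h1
      change φ σ k - (φ σ (g * k) - φ σ g) = 0 at h3
      linear_combination -h3
  · rw [Submodule.mem_bot]
    constructor
    · rintro rfl
      exact ⟨0, by simp⟩
    · rintro ⟨τ, rfl⟩
      refine funext fun g ↦ ULift.up_injective ?_
      rw [hφ, trivRep_d_apply₁, ← mul_one g, trivRep_cochain_invariant₁, sub_self]
      rfl

/-- The dictionary is c(g, h) = σ(1, g, gh). Homogeneous cochains are curried continuous maps; local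
compactness of Γ makes the uncurried cocycle jointly continuous. -/
theorem cohDim_two_eq [CompactSpace Γ] [T2Space Γ] :
    cohDim p 2 Γ = Module.finrank (ZMod p) (contH₂ p Γ) := by
  let φ : (homogeneousCochains (trivRep p Γ)).X 2 →ₗ[ZMod p] (Γ → Γ → ZMod p) :=
    { toFun σ g h := (σ.1 1 g (g * h)).down
      map_add' _ _ := rfl
      map_smul' _ _ := rfl }
  have hφ (σ) (g h : Γ) : ULift.up (φ σ g h) = σ.1 1 g (g * h) := rfl
  have hφ' (σ) (x y z : Γ) : σ.1 x y z = ULift.up (φ σ (x⁻¹ * y) (y⁻¹ * z)) := by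
    rw [hφ, ← trivRep_cochain_invariant₃ σ x⁻¹, inv_mul_cancel]
    congr 1; group
  refine finrank_topModule_homology (homogeneousCochains (trivRep p Γ)) 1 φ ?_
    (contCocycle₂ p Γ) ((contFun p Γ).map (coboundary₂ p Γ)) (fun f ↦ ?_) (fun f ↦ ?_)
  · intro σ τ h
    refine Subtype.ext (ContinuousMap.ext fun x ↦ ContinuousMap.ext fun y ↦
      ContinuousMap.ext fun z ↦ ?_)
    rw [hφ', hφ', h]
  · constructor
    · rintro ⟨hf, hm⟩
      refine ⟨homogeneousOfFun₂ f hf, trivRep_d_eq_zero₃.2 fun x y z w ↦ ?_,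
        funext fun g ↦ funext fun h ↦ ?_⟩
      · have := hm (x⁻¹ * y) (y⁻¹ * z) (z⁻¹ * w)
        rw [show x⁻¹ * y * (y⁻¹ * z) = x⁻¹ * z by group,
          show y⁻¹ * z * (z⁻¹ * w) = y⁻¹ * w by group] at this
        exact congrArg ULift.up (by linear_combination -this :
          f (y⁻¹ * z) (z⁻¹ * w) - (f (x⁻¹ * z) (z⁻¹ * w) -
            (f (x⁻¹ * y) (y⁻¹ * w) - f (x⁻¹ * y) (y⁻¹ * z))) = 0)
      · change f (1⁻¹ * g) (g⁻¹ * (g * h)) = f g h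
        simp
    · rintro ⟨σ, h, rfl⟩
      refine ⟨?_, fun a b c ↦ ?_⟩
      · have hc : Continuous fun x : Γ × Γ ↦ σ.1 1 x.1 x.2 :=
          ContinuousMap.continuous_uncurry_of_continuous (σ.1 1)
        exact continuous_uliftDown.comp (hc.comp (f := fun x : Γ × Γ ↦ (x.1, x.1 * x.2))
          (by fun_prop))
      · have h1 := trivRep_d_eq_zero₃.1 h 1 a (a * b) (a * b * c)
        simp only [hφ'] at h1
        rw [show a⁻¹ * (a * b) = b by group, show (a * b)⁻¹ * (a * b * c) = c by group,
          show a⁻¹ * (a * b * c) = b * c by group, inv_one, one_mul, one_mul] at h1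
        have h3 := congrArg ULift.down h1
        change φ σ b c - (φ σ (a * b) c - (φ σ a (b * c) - φ σ a b)) = 0 at h3
        linear_combination -h3
  · constructor
    · rintro ⟨b, hb, rfl⟩
      refine ⟨homogeneousOfFun₁ b hb, funext fun g ↦ funext fun h ↦ ULift.up_injective ?_⟩
      rw [hφ, trivRep_d_apply₂]
      exact congrArg ULift.up (by simp [coboundary₂]; ring :
        b (g⁻¹ * (g * h)) - (b (1⁻¹ * (g * h)) - b (1⁻¹ * g)) = coboundary₂ p Γ b g h)
    · rintro ⟨τ, rfl⟩
      refine ⟨fun g ↦ (τ.1 1 g).down, continuous_uliftDown.comp (τ.1 1).continuous,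
        funext fun g ↦ funext fun h ↦ ULift.up_injective ?_⟩
      rw [hφ, trivRep_d_apply₂]
      have h2 := trivRep_cochain_invariant₂ τ g 1 h
      rw [mul_one] at h2
      rw [h2]
      exact congrArg ULift.up (by simp only [coboundary₂, LinearMap.coe_mk, AddHom.coe_mk]; ring :
        coboundary₂ p Γ (fun g ↦ (τ.1 1 g).down) g h =
          (τ.1 1 h).down - ((τ.1 1 (g * h)).down - (τ.1 1 g).down))

end LowDegree

/-! ### A dimension count. -/

section LinearAlgebra

variable {F U V W : Type*} [Field F] [AddCommGroup U] [AddCommGroup V] [AddCommGroup W]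
  [Module F U] [Module F V] [Module F W]

/-- If the kernel of `f : V → W` lies in the image of `q : U → V`, then
`dim V ≤ dim U + dim W`. -/
theorem finite_and_finrank_le_of_ker_le_range [Module.Finite F U] [Module.Finite F W]
    (q : U →ₗ[F] V) (f : V →ₗ[F] W) (h : LinearMap.ker f ≤ LinearMap.range q) :
    Module.Finite F V ∧ Module.finrank F V ≤ Module.finrank F U + Module.finrank F W := by
  have hker : Module.Finite F (LinearMap.ker f) := Submodule.finiteDimensional_of_le h
  have hquot : Module.Finite F (V ⧸ LinearMap.ker f) :=
    Module.Finite.equiv f.quotKerEquivRange.symm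
  have hV : Module.Finite F V := Module.Finite.of_submodule_quotient (LinearMap.ker f)
  refine ⟨hV, ?_⟩
  rw [← LinearMap.finrank_range_add_finrank_ker f, add_comm]
  exact add_le_add ((Submodule.finrank_mono h).trans (LinearMap.finrank_range_le q))
    (Submodule.finrank_le _)

end LinearAlgebra

/-! ### Central extensions by ℤ/p: descent, degree one, and the kernel of inflation. -/

section CentralExtension

variable {p : ℕ} {Γ' Γ : Type*} [Group Γ'] [TopologicalSpace Γ']
  [Group Γ] [TopologicalSpace Γ]

/-- A continuous surjection `π : Γ' → Γ` whose kernel is generated by a central element `s` with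
`s ^ p = 1`, together with a continuous map `t : Γ' → ZMod p` that is equivariant under
translation by `s`. -/
structure IsCentralZModExtension (π : Γ' →* Γ) (s : Γ') (t : Γ' → ZMod p) : Prop where
  continuous_hom : Continuous π
  surjective : Function.Surjective π
  comm : ∀ g, s * g = g * s
  ker : ∀ x, π x = 1 ↔ ∃ i : ℕ, x = s ^ i
  pow : s ^ p = 1
  continuous_retraction : Continuous t
  retraction_mul : ∀ g, t (s * g) = 1 + t g
  retraction_one : t 1 = 0

/-- Pulling back functions of one variable. -/
def pullback₁ (p : ℕ) (π : Γ' → Γ) : (Γ → ZMod p) →ₗ[ZMod p] (Γ' → ZMod p) :=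
  LinearMap.funLeft _ _ π

/-- Pulling back functions of two variables. -/
def pullback₂ (p : ℕ) (π : Γ' → Γ) : (Γ → Γ → ZMod p) →ₗ[ZMod p] (Γ' → Γ' → ZMod p) where
  toFun c g h := c (π g) (π h)
  map_add' _ _ := rfl
  map_smul' _ _ := rfl

omit [TopologicalSpace Γ'] [TopologicalSpace Γ] in
theorem pullback₂_coboundary₂ (π : Γ' →* Γ) (b : Γ → ZMod p) :
    pullback₂ p π (coboundary₂ p Γ b) = coboundary₂ p Γ' (pullback₁ p π b) := by
  ext g h
  simp [pullback₂, coboundary₂, pullback₁, LinearMap.funLeft]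

theorem coboundary₂_mem_contCocycle₂ [IsTopologicalGroup Γ] {b : Γ → ZMod p} (hb : Continuous b) :
    coboundary₂ p Γ b ∈ contCocycle₂ p Γ := by
  refine ⟨?_, fun g h k ↦ ?_⟩
  · simp only [coboundary₂, LinearMap.coe_mk, AddHom.coe_mk]
    fun_prop
  · simp only [coboundary₂, LinearMap.coe_mk, AddHom.coe_mk, mul_assoc]
    ring

/-- Inflation in degree two. -/
def inflation₂ (p : ℕ) (π : Γ' →* Γ) (hπ : Continuous π) :
    contH₂ p Γ →ₗ[ZMod p] contH₂ p Γ' :=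
  Submodule.mapQ _ _ ((pullback₂ p π).restrict (p := contCocycle₂ p Γ) (q := contCocycle₂ p Γ')
    (fun c hc ↦ ⟨hc.1.comp (f := fun x : Γ' × Γ' ↦ (π x.1, π x.2)) (by fun_prop), fun g h k ↦ by
      simpa [pullback₂] using hc.2 (π g) (π h) (π k)⟩)) (by
    rintro ⟨c, hc⟩ ⟨b, hb, h⟩
    refine ⟨pullback₁ p π b, hb.comp hπ, ?_⟩
    rw [← pullback₂_coboundary₂, h]
    rfl)

theorem contCocycle₂.apply_one_right {c : Γ → Γ → ZMod p} (hc : c ∈ contCocycle₂ p Γ) (g : Γ) :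
    c g 1 = c 1 1 := by
  have := hc.2 g 1 1
  simp only [mul_one] at this
  linear_combination this

theorem contCocycle₂.apply_one_left {c : Γ → Γ → ZMod p} (hc : c ∈ contCocycle₂ p Γ) (g : Γ) :
    c 1 g = c 1 1 := by
  have := hc.2 1 1 g
  simp only [one_mul] at this
  linear_combination -this

namespace IsCentralZModExtension

variable {π : Γ' →* Γ} {s : Γ'} {t : Γ' → ZMod p}

theorem map_generator (H : IsCentralZModExtension π s t) : π s = 1 := (H.ker s).2 ⟨1, by simp⟩

theorem retraction_pow_mul (H : IsCentralZModExtension π s t) (i : ℕ) (g : Γ') :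
    t (s ^ i * g) = i + t g := by
  induction i with
  | zero => simp
  | succ i ih => rw [pow_succ', mul_assoc, H.retraction_mul, ih]; push_cast; ring

theorem retraction_pow (H : IsCentralZModExtension π s t) (i : ℕ) : t (s ^ i) = i := by
  simpa [H.retraction_one] using H.retraction_pow_mul i 1

theorem eq_of_map_eq (H : IsCentralZModExtension π s t) {Y : Type*} {f : Γ' → Y}
    (hf : ∀ g, f (s * g) = f g) {x y : Γ'} (h : π x = π y) : f x = f y := by
  obtain ⟨i, hi⟩ := (H.ker (x * y⁻¹)).1 (by simp [h])
  have hpow : ∀ i : ℕ, f (s ^ i * y) = f y := fun i ↦ by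
    induction i with
    | zero => simp
    | succ i ih => rw [pow_succ', mul_assoc, hf, ih]
  rw [← hpow i, ← hi, inv_mul_cancel_right]

theorem isQuotientMap [CompactSpace Γ'] [T2Space Γ] (H : IsCentralZModExtension π s t) :
    Topology.IsQuotientMap π :=
  H.continuous_hom.isClosedMap.isQuotientMap H.continuous_hom H.surjective

theorem isQuotientMap_prodMap [CompactSpace Γ'] [T2Space Γ] (H : IsCentralZModExtension π s t) :
    Topology.IsQuotientMap (Prod.map π π) :=
  (H.continuous_hom.prodMap H.continuous_hom).isClosedMap.isQuotientMap
    (H.continuous_hom.prodMap H.continuous_hom) (H.surjective.prodMap H.surjective)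

/-- An s-invariant function is constant on the fibres of π, and π is a quotient map by compactness,
so the descended function is continuous. -/
theorem exists_descent₁ [CompactSpace Γ'] [T2Space Γ] (H : IsCentralZModExtension π s t)
    {f : Γ' → ZMod p} (hf : Continuous f) (hs : ∀ g, f (s * g) = f g) :
    ∃ f₀ : Γ → ZMod p, Continuous f₀ ∧ pullback₁ p π f₀ = f := by
  have h (g : Γ') : f (Function.surjInv H.surjective (π g)) = f g :=
    H.eq_of_map_eq hs (Function.surjInv_eq H.surjective (π g))
  refine ⟨fun x ↦ f (Function.surjInv H.surjective x), ?_, funext h⟩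
  rw [H.isQuotientMap.continuous_iff]
  exact hf.congr fun g ↦ (h g).symm

theorem exists_descent₂ [CompactSpace Γ'] [T2Space Γ] (H : IsCentralZModExtension π s t)
    {c : Γ' → Γ' → ZMod p} (hc : c ∈ contCocycle₂ p Γ') (hl : ∀ g h, c (s * g) h = c g h)
    (hr : ∀ g h, c g (s * h) = c g h) :
    ∃ c₀ ∈ contCocycle₂ p Γ, pullback₂ p π c₀ = c := by
  have h (g k : Γ') :
      c (Function.surjInv H.surjective (π g)) (Function.surjInv H.surjective (π k)) = c g k :=
    (H.eq_of_map_eq (f := fun g ↦ c g _) (fun g ↦ hl g _)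
      (Function.surjInv_eq H.surjective (π g))).trans
      (H.eq_of_map_eq (hr g) (Function.surjInv_eq H.surjective (π k)))
  refine ⟨fun x y ↦ c (Function.surjInv H.surjective x) (Function.surjInv H.surjective y),
    ⟨?_, fun x y z ↦ ?_⟩, funext fun g ↦ funext fun k ↦ h g k⟩
  · rw [H.isQuotientMap_prodMap.continuous_iff]
    exact hc.1.congr fun g ↦ (h g.1 g.2).symm
  · obtain ⟨g, rfl⟩ := H.surjective x
    obtain ⟨k, rfl⟩ := H.surjective y
    obtain ⟨l, rfl⟩ := H.surjective z
    simp only [← map_mul, h]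
    exact hc.2 g k l

variable [Fact p.Prime]

/-- Evaluation of homomorphisms at an element. -/
def _root_.contHom.eval (p : ℕ) (s : Γ') : contHom p Γ' →ₗ[ZMod p] ZMod p :=
  LinearMap.proj s ∘ₗ Submodule.subtype _

/-- Inflation in degree one. -/
def _root_.inflation₁ (p : ℕ) (π : Γ' →* Γ) (hπ : Continuous π) :
    contHom p Γ →ₗ[ZMod p] contHom p Γ' :=
  (pullback₁ p π).restrict fun _ hf ↦ ⟨hf.1.comp hπ, fun g h ↦ by
    simp [pullback₁, LinearMap.funLeft, hf.2]⟩

theorem ker_eval_le_range_inflation₁ [CompactSpace Γ'] [T2Space Γ]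
    (H : IsCentralZModExtension π s t) :
    LinearMap.ker (contHom.eval p s) ≤ LinearMap.range (inflation₁ p π H.continuous_hom) := by
  rintro ⟨f, hf⟩ hs
  replace hs : f s = 0 := hs
  obtain ⟨f₀, hf₀, rfl⟩ := H.exists_descent₁ hf.1 fun g ↦ by rw [hf.2, hs, zero_add]
  refine ⟨⟨f₀, hf₀, fun x y ↦ ?_⟩, rfl⟩
  obtain ⟨g, rfl⟩ := H.surjective x
  obtain ⟨k, rfl⟩ := H.surjective y
  rw [← map_mul]
  exact hf.2 g k

theorem finrank_contHom_le [CompactSpace Γ'] [T2Space Γ] [Module.Finite (ZMod p) (contHom p Γ)]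
    (H : IsCentralZModExtension π s t) :
    Module.finrank (ZMod p) (contHom p Γ') ≤ Module.finrank (ZMod p) (contHom p Γ) + 1 := by
  simpa using (finite_and_finrank_le_of_ker_le_range _ _ H.ker_eval_le_range_inflation₁).2

theorem finrank_ker_eval_le [CompactSpace Γ'] [T2Space Γ] [Module.Finite (ZMod p) (contHom p Γ)]
    (H : IsCentralZModExtension π s t) :
    Module.Finite (ZMod p) (LinearMap.ker (contHom.eval p s)) ∧
    Module.finrank (ZMod p) (LinearMap.ker (contHom.eval p s)) ≤
      Module.finrank (ZMod p) (contHom p Γ) :=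
  ⟨Submodule.finiteDimensional_of_le H.ker_eval_le_range_inflation₁,
    (Submodule.finrank_mono H.ker_eval_le_range_inflation₁).trans (LinearMap.finrank_range_le _)⟩

/-- The kernel of inflation is spanned by the class of the extension. -/
theorem exists_ker_inflation₂_le [IsTopologicalGroup Γ'] [CompactSpace Γ'] [T2Space Γ]
    (H : IsCentralZModExtension π s t) : ∃ ε : contH₂ p Γ,
    LinearMap.ker (inflation₂ p π H.continuous_hom) ≤
      LinearMap.range (LinearMap.toSpanSingleton (ZMod p) _ ε) := by
  -- The coboundary of t is invariant under s in each variable because t only shifts by 1. It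
  -- descends to a cocycle c₀ whose class is the ε sought.
  obtain ⟨c₀, hc₀, h₀⟩ := H.exists_descent₂
    (coboundary₂_mem_contCocycle₂ (p := p) H.continuous_retraction)
    (fun g h ↦ by simp only [coboundary₂, LinearMap.coe_mk, AddHom.coe_mk, mul_assoc,
      H.retraction_mul]; ring) (fun g h ↦ by
      have : g * (s * h) = s * (g * h) := by rw [← mul_assoc, ← H.comm, mul_assoc]
      simp only [coboundary₂, LinearMap.coe_mk, AddHom.coe_mk, this, H.retraction_mul]; ring)
  refine ⟨Submodule.Quotient.mk ⟨c₀, hc₀⟩, fun x hx ↦ ?_⟩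
  obtain ⟨⟨c, hc⟩, rfl⟩ := Submodule.Quotient.mk_surjective _ x
  obtain ⟨b, hb, h⟩ := (Submodule.Quotient.mk_eq_zero _).1 hx
  replace h (g k : Γ') : b k - b (g * k) + b g = c (π g) (π k) := congrFun₂ h g k
  -- Since c(1, π g) = c(1, 1), translation by s shifts b by the constant b(s) - c(1, 1).
  -- Subtracting that multiple of t makes b invariant.
  obtain ⟨b₀, hb₀, hb'⟩ := H.exists_descent₁ (f := fun g ↦ b g - (b s - c 1 1) * t g)
    (hb.sub (continuous_const.mul H.continuous_retraction)) fun g ↦ by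
      have := h s g
      rw [H.map_generator, contCocycle₂.apply_one_left hc] at this
      rw [H.retraction_mul]
      linear_combination -this
  refine ⟨b s - c 1 1, ?_⟩
  rw [LinearMap.toSpanSingleton_apply, ← Submodule.Quotient.mk_smul, eq_comm, Submodule.Quotient.eq]
  refine ⟨b₀, hb₀, funext fun x ↦ funext fun y ↦ ?_⟩
  obtain ⟨g, rfl⟩ := H.surjective x
  obtain ⟨k, rfl⟩ := H.surjective y
  have h₁ (g : Γ') : b₀ (π g) = b g - (b s - c 1 1) * t g := congrFun hb' g
  have h₂ : c₀ (π g) (π k) = t k - t (g * k) + t g := congrFun₂ h₀ g k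
  change b₀ (π k) - b₀ (π g * π k) + b₀ (π g) = c (π g) (π k) - (b s - c 1 1) * c₀ (π g) (π k)
  rw [← map_mul, h₁, h₁, h₁, h₂, ← h]
  ring

end IsCentralZModExtension

end CentralExtension

/-! ### The bound on H² of a central extension. -/

section CentralExtension

variable {p : ℕ} [Fact p.Prime] {Γ' Γ : Type*} [Group Γ'] [TopologicalSpace Γ']
  [Group Γ] [TopologicalSpace Γ]

/-- The obstruction to trivializing a 2-cocycle on the cyclic subgroup generated by `s`. -/
def contCocycle₂.normSum (p : ℕ) (s : Γ') : contCocycle₂ p Γ' →ₗ[ZMod p] ZMod p where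
  toFun c := ∑ i ∈ Finset.range p, c.1 (s ^ i) s
  map_add' _ _ := Finset.sum_add_distrib
  map_smul' _ _ := (Finset.mul_sum _ _ _).symm

/-- Commutation with a central element `s`, as a homomorphism vanishing at `s`. -/
def contCocycle₂.commutator (p : ℕ) [Fact p.Prime] (s : Γ') (hs : ∀ g, s * g = g * s) :
    contCocycle₂ p Γ' →ₗ[ZMod p] LinearMap.ker (contHom.eval p s) where
  toFun c := ⟨⟨fun g ↦ c.1 s g - c.1 g s,
    (c.2.1.comp (f := fun g ↦ (s, g)) (by fun_prop)).sub
      (c.2.1.comp (f := fun g ↦ (g, s)) (by fun_prop)), fun g h ↦ by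
      have h₁ := c.2.2 s g h
      have h₂ := c.2.2 g s h
      have h₃ := c.2.2 g h s
      rw [← hs] at h₂ h₃
      linear_combination h₂ - h₁ - h₃⟩, sub_self _⟩
  map_add' c d := Subtype.ext (Subtype.ext (funext fun g ↦ add_sub_add_comm _ _ _ _))
  map_smul' a c := Subtype.ext (Subtype.ext (funext fun g ↦ (mul_sub _ _ _).symm))

/-- Summing c(sⁱ, s) solves the cochain equation on ℕ; vanishing of `normSum` makes the solution
p-periodic, hence a function on ℤ/p. -/
theorem contCocycle₂.exists_trivialization {s : Γ'} (hs : s ^ p = 1) {c : Γ' → Γ' → ZMod p}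
    (hc : c ∈ contCocycle₂ p Γ') (h : contCocycle₂.normSum p s ⟨c, hc⟩ = 0) :
    ∃ e : ZMod p → ZMod p, ∀ i j : ℕ, e ↑(i + j) = e i + e j + c (s ^ i) (s ^ j) := by
  -- The constant -c(1, 1) is forced by the case i = j = 0, as c need not be normalized.
  let e : ℕ → ZMod p := fun n ↦ -c 1 1 + ∑ i ∈ Finset.range n, c (s ^ i) s
  have hsucc (n : ℕ) : e (n + 1) = e n + c (s ^ n) s := by
    simp only [e, Finset.sum_range_succ]; ring
  have hadd (i j : ℕ) : e (i + j) = e i + e j + c (s ^ i) (s ^ j) := by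
    induction j with
    | zero =>
      simp only [add_zero, pow_zero, contCocycle₂.apply_one_right hc]
      simp [e]
    | succ j ih =>
      have := hc.2 (s ^ i) (s ^ j) s
      rw [← pow_add, ← pow_succ] at this
      rw [← add_assoc, hsucc, ih, hsucc]
      linear_combination this
  have hp : e p = -c 1 1 := by
    have : ∑ i ∈ Finset.range p, c (s ^ i) s = 0 := h
    simp [e, this]
  have hper (i : ℕ) : e (i + p) = e i := by
    rw [hadd, hp, hs, contCocycle₂.apply_one_right hc (s ^ i)]; ring
  have hmod (i : ℕ) : e (i % p) = e i := Function.Periodic.map_mod_nat hper i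
  refine ⟨fun x ↦ e x.val, fun i j ↦ ?_⟩
  simp only [ZMod.val_natCast, hmod, hadd]

namespace IsCentralZModExtension

variable {π : Γ' →* Γ} {s : Γ'} {t : Γ' → ZMod p}

theorem normSum_coboundary₂ (H : IsCentralZModExtension π s t) {b : Γ' → ZMod p}
    (hb : coboundary₂ p Γ' b ∈ contCocycle₂ p Γ') : contCocycle₂.normSum p s ⟨_, hb⟩ = 0 := by
  change ∑ i ∈ Finset.range p, (b s - b (s ^ i * s) + b (s ^ i)) = 0
  simp only [← pow_succ, sub_add]
  rw [Finset.sum_sub_distrib, ← neg_inj, neg_sub, Finset.sum_range_sub (fun i ↦ b (s ^ i)), H.pow]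
  simp

theorem commutator_coboundary₂ (H : IsCentralZModExtension π s t) {b : Γ' → ZMod p}
    (hb : coboundary₂ p Γ' b ∈ contCocycle₂ p Γ') :
    contCocycle₂.commutator p s H.comm ⟨_, hb⟩ = 0 := by
  refine Subtype.ext (Subtype.ext (funext fun g ↦ ?_))
  change b g - b (s * g) + b s - (b s - b (g * s) + b g) = 0
  rw [H.comm]; ring

/-- The two obstructions are the restriction of c to ⟨s⟩ and its antisymmetrized pairing with s.
When both vanish, two coboundary corrections make c invariant under s in each variable, and it
descends. -/
theorem exists_eq_pullback_add_coboundary [IsTopologicalGroup Γ'] [CompactSpace Γ'] [T2Space Γ]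
    (H : IsCentralZModExtension π s t) {c : Γ' → Γ' → ZMod p} (hc : c ∈ contCocycle₂ p Γ')
    (hn : contCocycle₂.normSum p s ⟨c, hc⟩ = 0)
    (hcomm : contCocycle₂.commutator p s H.comm ⟨c, hc⟩ = 0) :
    ∃ c₀ ∈ contCocycle₂ p Γ, ∃ b, Continuous b ∧ pullback₂ p π c₀ - c = coboundary₂ p Γ' b := by
  obtain ⟨e, he⟩ := contCocycle₂.exists_trivialization H.pow hc hn
  have hb₁ : Continuous fun g ↦ e (t g) :=
    continuous_of_discreteTopology.comp H.continuous_retraction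
  -- First correction: t(sⁱ) = i, so the coboundary of e ∘ t cancels c on ⟨s⟩ × ⟨s⟩.
  let c₁ := c + coboundary₂ p Γ' fun g ↦ e (t g)
  have hc₁ : c₁ ∈ contCocycle₂ p Γ' := add_mem hc (coboundary₂_mem_contCocycle₂ hb₁)
  have hpow (i j : ℕ) : c₁ (s ^ i) (s ^ j) = 0 := by
    change c (s ^ i) (s ^ j) + (e (t (s ^ j)) - e (t (s ^ i * s ^ j)) + e (t (s ^ i))) = 0
    rw [← pow_add, H.retraction_pow, H.retraction_pow, H.retraction_pow, he]; ring
  have hcomm₁ (g : Γ') : c₁ g s = c₁ s g := by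
    have h : c s g - c g s = 0 := congrFun (congrArg (fun x ↦ x.1.1) hcomm) g
    change c g s + (e (t s) - e (t (g * s)) + e (t g)) = c s g + (e (t g) - e (t (s * g)) + e (t s))
    rw [H.comm]; linear_combination -h
  let u : Γ' → Γ' := fun g ↦ s ^ (t g).val
  have hu : Continuous u :=
    (continuous_of_discreteTopology (f := fun x : ZMod p ↦ s ^ x.val)).comp H.continuous_retraction
  have hus (g : Γ') : u (s * g) = s * u g := by
    simp only [u, H.retraction_mul, ← pow_succ']
    rw [pow_eq_pow_mod _ H.pow, pow_eq_pow_mod ((t g).val + 1) H.pow, ← ZMod.val_natCast,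
      ← ZMod.val_natCast]
    congr 2
    simp [add_comm]
  -- Second correction: u(g) is the ⟨s⟩-part of g, and u(g)⁻¹g is unchanged when g is replaced by
  -- sg. The cocycle identity for s, u(g), u(g)⁻¹g then gives f(sg) = f(g) - c₁(s, g).
  let f : Γ' → ZMod p := fun g ↦ - c₁ (u g) ((u g)⁻¹ * g)
  have hf : Continuous f :=
    (hc₁.1.comp (f := fun g ↦ (u g, (u g)⁻¹ * g)) (by fun_prop)).neg
  have hfs (g : Γ') : f (s * g) = f g - c₁ s g := by
    have h₁ := hc₁.2 s (u g) ((u g)⁻¹ * g)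
    have h₂ : c₁ s (u g) = 0 := by simpa using hpow 1 (t g).val
    rw [mul_inv_cancel_left, h₂] at h₁
    simp only [f, hus, mul_inv_rev]
    rw [mul_assoc, inv_mul_cancel_left]
    linear_combination -h₁
  let c₂ := c₁ - coboundary₂ p Γ' f
  have hc₂ : c₂ ∈ contCocycle₂ p Γ' := sub_mem hc₁ (coboundary₂_mem_contCocycle₂ hf)
  have hc₂_apply (g h : Γ') : c₂ g h = c₁ g h - (f h - f (g * h) + f g) := rfl
  obtain ⟨c₀, hc₀, h₀⟩ := H.exists_descent₂ hc₂ (fun g h ↦ by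
    have := hc₁.2 s g h
    rw [hc₂_apply, hc₂_apply, mul_assoc, hfs, hfs]
    linear_combination this) (fun g h ↦ by
    have h₁ := hc₁.2 s g h
    have h₂ := hc₁.2 g s h
    have h₃ : g * (s * h) = s * (g * h) := by rw [← mul_assoc, ← H.comm, mul_assoc]
    rw [hcomm₁, ← H.comm] at h₂
    rw [hc₂_apply, hc₂_apply, h₃, hfs, hfs]
    linear_combination h₁ - h₂)
  refine ⟨c₀, hc₀, fun g ↦ e (t g) - f g, hb₁.sub hf, ?_⟩
  have : (fun g ↦ e (t g) - f g) = (fun g ↦ e (t g)) - f := rfl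
  rw [h₀, this, map_sub]
  simp only [c₂, c₁]
  abel

/-- The classes of `Γ'` whose restriction invariants vanish are inflated from `Γ`. -/
theorem exists_obstruction [IsTopologicalGroup Γ'] [CompactSpace Γ'] [T2Space Γ]
    (H : IsCentralZModExtension π s t) :
    ∃ f : contH₂ p Γ' →ₗ[ZMod p] ZMod p × LinearMap.ker (contHom.eval p s),
      LinearMap.ker f ≤ LinearMap.range (inflation₂ p π H.continuous_hom) := by
  refine ⟨Submodule.liftQ _ ((contCocycle₂.normSum p s).prod
    (contCocycle₂.commutator p s H.comm)) ?_, ?_⟩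
  · rintro ⟨c, hc⟩ ⟨b, hb, rfl⟩
    exact Prod.ext (H.normSum_coboundary₂ hc) (H.commutator_coboundary₂ hc)
  · intro x hx
    obtain ⟨⟨c, hc⟩, rfl⟩ := Submodule.Quotient.mk_surjective _ x
    replace hx : (contCocycle₂.normSum p s ⟨c, hc⟩, contCocycle₂.commutator p s H.comm ⟨c, hc⟩) =
      0 := hx
    obtain ⟨c₀, hc₀, b, hb, h⟩ := H.exists_eq_pullback_add_coboundary hc (congrArg Prod.fst hx)
      (congrArg Prod.snd hx)
    exact ⟨Submodule.Quotient.mk ⟨c₀, hc₀⟩, (Submodule.Quotient.eq _).2 ⟨b, hb, h.symm⟩⟩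

/-- If `H²(Γ)` is infinite-dimensional then so is `H²(Γ')`; otherwise this is the bound given by the
filtration of `H²(Γ')` with graded pieces in `H²(Γ)`, `H¹(Γ)` and `H²(ZMod p)`. -/
theorem finrank_contH₂_le [IsTopologicalGroup Γ'] [CompactSpace Γ'] [T2Space Γ]
    [Module.Finite (ZMod p) (contHom p Γ)] (H : IsCentralZModExtension π s t) :
    Module.finrank (ZMod p) (contH₂ p Γ') ≤
      Module.finrank (ZMod p) (contH₂ p Γ) + Module.finrank (ZMod p) (contHom p Γ) + 1 := by
  obtain ⟨hfin, hle⟩ := H.finrank_ker_eval_le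
  by_cases h : Module.Finite (ZMod p) (contH₂ p Γ)
  · obtain ⟨f, hf⟩ := H.exists_obstruction
    have := (finite_and_finrank_le_of_ker_le_range _ f hf).2
    rw [Module.finrank_prod, Module.finrank_self] at this
    lia
  -- Inflation has kernel of dimension at most one, so H²(Γ') is infinite-dimensional too and its
  -- `finrank` is the default value 0.
  · obtain ⟨ε, hε⟩ := H.exists_ker_inflation₂_le
    have h' : ¬ Module.Finite (ZMod p) (contH₂ p Γ') := fun _ ↦
      h (finite_and_finrank_le_of_ker_le_range _ _ hε).1
    rw [Module.finrank_of_not_finite h']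
    exact Nat.zero_le _

end IsCentralZModExtension

end CentralExtension

/-! ### From a group extension of pro-p type to a central extension with a retraction. -/

section Extension

/-- Each q is compared with the chosen representative of its coset modulo the image of ι. -/
theorem exists_equivariant_retraction {A Q : Type*} [Group A] [Group Q] (ι : A →* Q)
    (hι : Function.Injective ι) (hc : ∀ a q, ι a * q = q * ι a) :
    ∃ τ : Q → A, ∀ a q, τ (ι a * q) = τ q * a := by
  have h (q : Q) : ∃ a, ι a = (Quotient.out (q : Q ⧸ ι.range))⁻¹ * q :=
    QuotientGroup.eq.1 (QuotientGroup.out_eq' (q : Q ⧸ ι.range))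
  choose τ hτ using h
  refine ⟨τ, fun a q ↦ hι ?_⟩
  have hq : ((ι a * q : Q) : Q ⧸ ι.range) = q := by
    rw [hc, QuotientGroup.eq]
    exact ⟨a⁻¹, by simp⟩
  rw [hτ, hq, map_mul, hτ, hc, mul_assoc]

/-- A topological group in which the `p`-power powers of every element accumulate at `1`. -/
def IsTopologicallyPTorsion (p : ℕ) (Γ : Type*) [Group Γ] [TopologicalSpace Γ] : Prop :=
  ∀ g : Γ, ∀ U ∈ nhds (1 : Γ), ∃ n : ℕ, g ^ p ^ n ∈ U

variable {p : ℕ} [Fact p.Prime] {Γ' Γ : Type*} [Group Γ'] [TopologicalSpace Γ'] [Group Γ]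
  (S : GroupExtension (Multiplicative (ZMod p)) Γ' Γ)

omit [TopologicalSpace Γ'] in
theorem GroupExtension.inl_eq_pow (a : Multiplicative (ZMod p)) :
    S.inl a = S.inl (Multiplicative.ofAdd 1) ^ a.toAdd.val := by
  rw [← map_pow, ← ofAdd_nsmul]
  simp

/-- Conjugation by g sends s to sᵐ, so g^(pⁿ) sends s to s^(m^(pⁿ)), which is sᵐ by Fermat. Some
g^(pⁿ) is close enough to 1 to fix s, since the kernel is finite and hence discrete. Thus sᵐ = s. -/
theorem GroupExtension.inl_comm [IsTopologicalGroup Γ'] [T2Space Γ']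
    (hp : IsTopologicallyPTorsion p Γ') (g : Γ') :
    S.inl (Multiplicative.ofAdd 1) * g = g * S.inl (Multiplicative.ofAdd 1) := by
  set s := S.inl (Multiplicative.ofAdd 1) with hs
  obtain ⟨m, hm⟩ : ∃ m : ℕ, g * s * g⁻¹ = s ^ m :=
    ⟨_, (S.inl_conjAct_comm).symm.trans (S.inl_eq_pow _)⟩
  have hspow (i j : ℕ) (hij : (i : ZMod p) = j) : s ^ i = s ^ j := by
    simp only [hs, ← map_pow, ← ofAdd_nsmul, nsmul_one, hij]
  have hconj (n : ℕ) : g ^ n * s * (g ^ n)⁻¹ = s ^ m ^ n := by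
    induction n with
    | zero => simp
    | succ n ih =>
      calc g ^ (n + 1) * s * (g ^ (n + 1))⁻¹ = g * (g ^ n * s * (g ^ n)⁻¹) * g⁻¹ := by
            rw [pow_succ']; group
        _ = s ^ m ^ (n + 1) := by rw [ih, ← conj_pow, hm, ← pow_mul, pow_succ']
  have hfin : (Set.range S.inl \ {s}).Finite := (Set.finite_range _).subset Set.sdiff_subset
  have hU : {h : Γ' | h * s * h⁻¹ ∈ (Set.range S.inl \ {s})ᶜ} ∈ nhds (1 : Γ') := by
    refine (hfin.isClosed.isOpen_compl.preimage (by fun_prop)).mem_nhds ?_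
    simp
  obtain ⟨n, hn⟩ := hp g _ hU
  have h₁ : g ^ p ^ n * s * (g ^ p ^ n)⁻¹ = s ^ m := by
    rw [hconj]
    exact hspow _ _ (by rw [Nat.cast_pow, ZMod.pow_card_pow])
  have h₂ : s ^ m = s := by
    by_contra hne
    refine hn ⟨⟨Multiplicative.ofAdd 1 ^ m, ?_⟩, ?_⟩
    · rw [map_pow, ← hs, h₁]
    · simpa [h₁] using hne
  rw [h₂] at hm
  exact (mul_inv_eq_iff_eq_mul.1 hm).symm

theorem GroupExtension.exists_isCentralZModExtension [TopologicalSpace Γ] [IsTopologicalGroup Γ']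
    [CompactSpace Γ'] [T2Space Γ'] [TotallyDisconnectedSpace Γ']
    (hp : IsTopologicallyPTorsion p Γ') (hS : Continuous S.rightHom) :
    ∃ t, IsCentralZModExtension (p := p) S.rightHom (S.inl (Multiplicative.ofAdd 1)) t := by
  set s := S.inl (Multiplicative.ofAdd 1) with hs
  have hfin : (Set.range S.inl \ {1}).Finite := (Set.finite_range _).subset Set.sdiff_subset
  -- V meets the finite kernel trivially, so the kernel embeds in the discrete quotient by V. A
  -- set-theoretic retraction there pulls back to a continuous one.
  obtain ⟨V, hV⟩ := ProfiniteGrp.exist_openNormalSubgroup_sub_open_nhds_of_one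
    (U := (Set.range S.inl \ {1})ᶜ) hfin.isClosed.isOpen_compl (by simp)
  let q : Γ' →* Γ' ⧸ V.toSubgroup := QuotientGroup.mk' V.toSubgroup
  have hq : Continuous q := continuous_quot_mk
  have : DiscreteTopology (Γ' ⧸ V.toSubgroup) := QuotientGroup.discreteTopology V.isOpen
  have hcomm := S.inl_comm hp
  obtain ⟨τ, hτ⟩ := exists_equivariant_retraction (q.comp S.inl) (by
    rw [injective_iff_map_eq_one]
    intro a ha
    have hmem : S.inl a ∈ V.toSubgroup := (QuotientGroup.eq_one_iff _).1 ha
    by_contra hne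
    refine hV hmem ⟨⟨a, rfl⟩, fun h ↦ hne (S.inl_injective (h.trans (map_one _).symm))⟩) (by
    intro a x
    obtain ⟨g, rfl⟩ := QuotientGroup.mk'_surjective _ x
    change q (S.inl a) * q g = q g * q (S.inl a)
    rw [← map_mul, ← map_mul, S.inl_eq_pow]
    congr 1
    exact (Commute.pow_left (hcomm g) _).eq)
  -- Subtracting τ(1) normalizes the retraction to vanish at 1 without affecting equivariance.
  refine ⟨fun g ↦ (τ (q g)).toAdd - (τ 1).toAdd, hS, S.rightHom_surjective, hcomm, fun x ↦ ?_, ?_,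
    ?_, fun g ↦ ?_, ?_⟩
  · rw [← MonoidHom.mem_ker, ← S.range_inl_eq_ker_rightHom]
    constructor
    · rintro ⟨a, rfl⟩
      exact ⟨_, S.inl_eq_pow a⟩
    · rintro ⟨i, rfl⟩
      exact ⟨Multiplicative.ofAdd 1 ^ i, map_pow _ _ _⟩
  · rw [hs, ← map_pow, ← ofAdd_nsmul]
    simp
  · exact (continuous_of_discreteTopology (f := fun x ↦ (τ x).toAdd - (τ 1).toAdd)).comp hq
  · have := hτ (Multiplicative.ofAdd 1) (q g)
    rw [map_mul]
    change (τ ((q.comp S.inl) (Multiplicative.ofAdd 1) * q g)).toAdd - _ = _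
    rw [this, toAdd_mul, toAdd_ofAdd]
    ring
  · simp

end Extension

/-! ### The tower group is topologically p-torsion. -/

section Tower

variable (p : ℕ) (k : Type*) [Field k]

instance hilbertTower_normal : Normal k (hilbertTower p k) := by
  rw [hilbertTower, sSup_eq_iSup']
  have (i : {F : IntermediateField k (AlgebraicClosure k) | FiniteDimensional k F ∧
      IsGalois k F ∧ (∃ n : ℕ, Module.finrank k F = p ^ n) ∧ IsEverywhereUnramified k F}) :
      Normal k i.1 := i.2.2.1.to_normal
  exact IntermediateField.normal_iSup _ _ _

instance hilbertTower_isGalois [CharZero k] : IsGalois k (hilbertTower p k) where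

variable {p k} in
theorem AlgEquiv.pow_pow_apply_eq_of_le {K : Type*} [Field K] [Algebra k K] {σ : Gal(K/k)} {x : K}
    {m n : ℕ} (h : (σ ^ p ^ m) x = x) (hmn : m ≤ n) : (σ ^ p ^ n) x = x := by
  obtain ⟨d, rfl⟩ := Nat.exists_eq_add_of_le hmn
  rw [pow_add, pow_mul]
  exact pow_mem (S := MulAction.stabilizer Gal(K/k) x) h _

/-- The elements fixed by some `p`-power power of an automorphism. -/
def pPowerFixed {K : Type*} [Field K] [Algebra k K] (σ : Gal(K/k)) : IntermediateField k K where
  carrier := {x | ∃ n : ℕ, (σ ^ p ^ n) x = x}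
  mul_mem' := fun ⟨m, hm⟩ ⟨n, hn⟩ ↦ ⟨max m n, by
    rw [map_mul, AlgEquiv.pow_pow_apply_eq_of_le hm (le_max_left _ _),
      AlgEquiv.pow_pow_apply_eq_of_le hn (le_max_right _ _)]⟩
  add_mem' := fun ⟨m, hm⟩ ⟨n, hn⟩ ↦ ⟨max m n, by
    rw [map_add, AlgEquiv.pow_pow_apply_eq_of_le hm (le_max_left _ _),
      AlgEquiv.pow_pow_apply_eq_of_le hn (le_max_right _ _)]⟩
  algebraMap_mem' r := ⟨0, AlgEquiv.commutes _ r⟩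
  inv_mem' := fun x ⟨m, hm⟩ ↦ ⟨m, by rw [map_inv₀, hm]⟩

theorem mem_pPowerFixed_of_isGalois {K : Type*} [Field K] [Algebra k K] (σ : Gal(K/k))
    (F : IntermediateField k K) [FiniteDimensional k F] [IsGalois k F] {n : ℕ}
    (hF : Module.finrank k F = p ^ n) : F ≤ pPowerFixed p k σ := by
  intro x hx
  refine ⟨n, ?_⟩
  have h : AlgEquiv.restrictNormalHom F (σ ^ p ^ n) = 1 := by
    rw [map_pow, ← hF, ← IsGalois.card_aut_eq_finrank, pow_card_eq_one']
  have h' := AlgEquiv.restrictNormal_commutes (σ ^ p ^ n) F ⟨x, hx⟩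
  change algebraMap F K (AlgEquiv.restrictNormalHom F (σ ^ p ^ n) ⟨x, hx⟩) = _ at h'
  rw [h] at h'
  exact h'.symm

/-- The elements fixed by some σ^(pⁿ) form a subfield. It contains each Galois layer of degree pⁿ,
where σ restricts to an element of a group of order pⁿ, so it contains their compositum. -/
theorem hilbertTower_exists_pow_fix (σ : towerGroup p k) (x : hilbertTower p k) :
    ∃ n : ℕ, (σ ^ p ^ n) x = x := by
  suffices h : hilbertTower p k ≤ IntermediateField.lift (pPowerFixed p k σ) from
    (IntermediateField.mem_lift x).1 (h x.2)
  refine sSup_le fun F hF ↦ ?_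
  obtain ⟨_, _, ⟨n, hn⟩, _⟩ := id hF
  have hle : F ≤ hilbertTower p k := le_sSup hF
  let e := IntermediateField.restrictAlgEquiv hle
  have : FiniteDimensional k (IntermediateField.restrict hle) := e.toLinearEquiv.finiteDimensional
  have : IsGalois k (IntermediateField.restrict hle) := IsGalois.of_algEquiv e
  have := mem_pPowerFixed_of_isGalois p k σ (IntermediateField.restrict hle)
    (e.toLinearEquiv.finrank_eq.symm.trans hn)
  rw [← IntermediateField.lift_restrict hle]
  exact IntermediateField.map_mono _ this

theorem isTopologicallyPTorsion_towerGroup : IsTopologicallyPTorsion p (towerGroup p k) := by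
  intro σ U hU
  obtain ⟨E, hE, hEU⟩ := (krullTopology_mem_nhds_one_iff _ _ _).1 hU
  choose n hn using hilbertTower_exists_pow_fix p k σ
  let b := Module.finBasis k E
  let m := Finset.univ.sup fun i ↦ n (b i)
  refine ⟨m, hEU ?_⟩
  have h : (σ ^ p ^ m).toLinearMap ∘ₗ E.val.toLinearMap = E.val.toLinearMap :=
    b.ext fun i ↦ AlgEquiv.pow_pow_apply_eq_of_le (hn (b i))
      (Finset.le_sup (f := fun i ↦ n (b i)) (Finset.mem_univ i))
  exact (IntermediateField.mem_fixingSubgroup_iff _ _).2 fun x hx ↦ LinearMap.congr_fun h ⟨x, hx⟩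

end Tower

/-! ### Unramified extensions: composita, discriminants and Hermite's theorem. -/

section Unramified

/-- `K / k` is unramified at every prime. -/
def IsUnramifiedAtPrimes (k K : Type*) [Field k] [Field K] [Algebra k K] : Prop :=
  ∀ (P : Ideal (𝓞 K)) [P.IsPrime], Algebra.IsUnramifiedAt (𝓞 k) P

variable {k K : Type*} [Field k] [NumberField k] [Field K] [NumberField K] [Algebra k K]

theorem IsUnramifiedAtPrimes.bot (F : Type*) [Field F] [NumberField F] [Algebra k F] [Algebra F K]
    [IsScalarTower k F K] (h : IsUnramifiedAtPrimes k K) : IsUnramifiedAtPrimes k F := by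
  intro P _
  obtain ⟨Q, hQ, hQP⟩ := Ideal.exists_isPrime_liesOver_of_faithfullyFlat (B := 𝓞 K) P
  have := h Q
  exact Algebra.IsUnramifiedAt.of_liesOver (𝓞 k) P Q

theorem inertia_eq_bot_of_isUnramifiedAtPrimes [IsGalois k K] (h : IsUnramifiedAtPrimes k K)
    (P : Ideal (𝓞 K)) [P.IsPrime] : P.inertia Gal(K/k) = ⊥ := by
  have := h P
  rw [← Subgroup.card_eq_one, Ideal.card_inertia_eq_ramificationIdxIn (P.under (𝓞 k)) P,
    Ideal.ramificationIdxIn_eq_ramificationIdx (P.under (𝓞 k)) P Gal(K/k),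
    Ideal.ramificationIdx_eq_one]

theorem isUnramifiedAtPrimes_of_inertia [IsGalois k K]
    (h : ∀ (P : Ideal (𝓞 K)) [P.IsPrime], P.inertia Gal(K/k) = ⊥) :
    IsUnramifiedAtPrimes k K := by
  intro P _
  rw [← Ideal.ramificationIdx_eq_one_iff,
    ← Ideal.ramificationIdxIn_eq_ramificationIdx (P.under (𝓞 k)) P Gal(K/k),
    ← Ideal.card_inertia_eq_ramificationIdxIn (G := Gal(K/k)) (P.under (𝓞 k)) P, h P]
  simp

omit [NumberField K] in
/-- The inertia group of a Galois extension fixes every unramified Galois subextension. -/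
theorem apply_eq_of_mem_inertia (F : Type*) [Field F] [NumberField F] [Algebra k F]
    [Algebra F K] [IsScalarTower k F K] [IsGalois k F] (h : IsUnramifiedAtPrimes k F)
    (P : Ideal (𝓞 K)) [P.IsPrime] {σ : Gal(K/k)} (hσ : σ ∈ P.inertia Gal(K/k)) (x : F) :
    σ (algebraMap F K x) = algebraMap F K x := by
  have h₁ : AlgEquiv.restrictNormalHom F σ ∈ (P.under (𝓞 F)).inertia Gal(F/k) := by
    intro y
    have h₂ : algebraMap (𝓞 F) (𝓞 K) (AlgEquiv.restrictNormalHom F σ • y) =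
        σ • algebraMap (𝓞 F) (𝓞 K) y :=
      RingOfIntegers.ext (AlgEquiv.restrictNormal_commutes σ F (y : F))
    change algebraMap (𝓞 F) (𝓞 K) (AlgEquiv.restrictNormalHom F σ • y - y) ∈ P
    rw [map_sub, h₂]
    exact hσ _
  rw [inertia_eq_bot_of_isUnramifiedAtPrimes h, Subgroup.mem_bot] at h₁
  have h₂ := AlgEquiv.restrictNormal_commutes σ F x
  change algebraMap F K (AlgEquiv.restrictNormalHom F σ x) = _ at h₂
  rw [h₁] at h₂
  exact h₂.symm

theorem natAbs_discr_of_isUnramifiedAtPrimes (h : IsUnramifiedAtPrimes k K) :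
    (discr K).natAbs = (discr k).natAbs ^ Module.finrank k K := by
  have h₁ : differentIdeal (𝓞 k) (𝓞 K) = ⊤ := by
    by_contra hne
    obtain ⟨P, hP, hle⟩ := Ideal.exists_le_maximal _ hne
    have := hP.isPrime
    exact dvd_differentIdeal_iff.1 (Ideal.dvd_iff_le.2 hle) (h P)
  rw [natAbs_discr_eq_absNorm_differentIdeal_mul_natAbs_discr_pow k (𝓞 k) K (𝓞 K), h₁]
  simp

/-- A finite compositum of unramified Galois extensions is unramified. -/
theorem isUnramifiedAtPrimes_iSup {A : Type*} [Field A] [Algebra k A] {ι : Type*} [Finite ι]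
    (F : ι → IntermediateField k A) [∀ i, FiniteDimensional k (F i)]
    [∀ i, IsGalois k (F i)] (h : ∀ i, IsUnramifiedAtPrimes k (F i)) :
    IsUnramifiedAtPrimes k (⨆ i, F i : IntermediateField k A) := by
  have hfin : FiniteDimensional k (⨆ i, F i : IntermediateField k A) :=
    IntermediateField.finiteDimensional_iSup_of_finite
  have hN : Normal k (⨆ i, F i : IntermediateField k A) := IntermediateField.normal_iSup _ _ _
  set M : IntermediateField k A := ⨆ i, F i with hM
  have := NumberField.of_module_finite k M
  have hF (i : ι) : NumberField (F i) := NumberField.of_module_finite k (F i)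
  have hG : IsGalois k M := ⟨⟩
  refine isUnramifiedAtPrimes_of_inertia fun P _ ↦ ?_
  rw [eq_bot_iff]
  intro σ hσ
  -- An inertia element of M fixes every F i, hence fixes their compositum M, and is therefore
  -- trivial.
  have hle : M ≤ IntermediateField.lift (IntermediateField.fixedField (Subgroup.zpowers σ)) := by
    refine iSup_le fun i x hx ↦ ?_
    have hiM : F i ≤ M := le_iSup F i
    let : Algebra (F i) M := (IntermediateField.inclusion hiM).toAlgebra
    have : IsScalarTower k (F i) M := IsScalarTower.of_algebraMap_eq fun _ ↦ rfl
    have h₁ : σ ⟨x, hiM hx⟩ = ⟨x, hiM hx⟩ := apply_eq_of_mem_inertia (F i) (h i) P hσ ⟨x, hx⟩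
    refine (IntermediateField.mem_lift (⟨x, hiM hx⟩ : M)).2 ?_
    rintro ⟨g, n, rfl⟩
    exact Subgroup.zpow_mem (MulAction.stabilizer Gal(M/k) (⟨x, hiM hx⟩ : M)) h₁ n
  rw [Subgroup.mem_bot]
  ext x
  exact congrArg _ ((IntermediateField.mem_lift x).1 (hle x.2) ⟨σ, Subgroup.mem_zpowers σ⟩)

theorem IntermediateField.exists_finset_le_iSup {k A : Type*} [Field k] [Field A] [Algebra k A]
    {ι : Type*} {f : ι → IntermediateField k A} (E : IntermediateField k A)
    [FiniteDimensional k E] (hE : E ≤ ⨆ i, f i) : ∃ s : Finset ι, E ≤ ⨆ i : s, f i := by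
  classical
  let b := Module.finBasis k E
  choose s hs using fun i ↦ IntermediateField.exists_finset_of_mem_iSup (hE (b i).2)
  refine ⟨Finset.univ.biUnion s, fun x hx ↦ ?_⟩
  have hmem (i) : (b i : A) ∈ ⨆ i : Finset.univ.biUnion s, f i := by
    refine (?_ : ⨆ j ∈ s i, f j ≤ _) (hs i)
    exact iSup₂_le fun j hj ↦ le_iSup (fun i : Finset.univ.biUnion s ↦ f i)
      ⟨j, Finset.mem_biUnion.2 ⟨i, Finset.mem_univ i, hj⟩⟩
  have hx' : x = ∑ i, b.repr ⟨x, hx⟩ i • (b i : A) := by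
    have := congrArg E.val (b.sum_repr ⟨x, hx⟩)
    rw [map_sum] at this
    simp only [map_smul] at this
    exact this.symm
  rw [hx']
  exact sum_mem fun i _ ↦ IntermediateField.smul_mem _ (hmem i)

/-- Every finite subextension of the tower is unramified. -/
theorem isUnramifiedAtPrimes_of_le_hilbertTower (p : ℕ)
    (E : IntermediateField k (AlgebraicClosure k))
    [FiniteDimensional k E] (hE : E ≤ hilbertTower p k) : IsUnramifiedAtPrimes k E := by
  rw [hilbertTower, sSup_eq_iSup'] at hE
  obtain ⟨s, hs⟩ := IntermediateField.exists_finset_le_iSup E hE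
  have (i : s) : FiniteDimensional k i.1.1 := i.1.2.1
  have (i : s) : IsGalois k i.1.1 := i.1.2.2.1
  have h := isUnramifiedAtPrimes_iSup (fun i : s ↦ i.1.1) fun i ↦ i.1.2.2.2.2.1
  have hfin : FiniteDimensional k (⨆ i : s, i.1.1 : IntermediateField k (AlgebraicClosure k)) :=
    IntermediateField.finiteDimensional_iSup_of_finite
  have := NumberField.of_module_finite k E
  have := NumberField.of_module_finite k
    (⨆ i : s, i.1.1 : IntermediateField k (AlgebraicClosure k))
  let : Algebra E (⨆ i : s, i.1.1 : IntermediateField k (AlgebraicClosure k)) :=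
    (IntermediateField.inclusion hs).toAlgebra
  have : IsScalarTower k E (⨆ i : s, i.1.1 : IntermediateField k (AlgebraicClosure k)) :=
    IsScalarTower.of_algebraMap_eq fun _ ↦ rfl
  exact h.bot E

/-- Hermite's theorem for unramified extensions of bounded degree. -/
theorem finite_isUnramifiedAtPrimes (k A : Type*) [Field k] [NumberField k] [Field A] [Algebra k A]
    (n : ℕ) : {E : IntermediateField k A | FiniteDimensional k E ∧ Module.finrank k E ≤ n ∧
      IsUnramifiedAtPrimes k E}.Finite := by
  have : CharZero A := charZero_of_injective_algebraMap (algebraMap k A).injective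
  -- Over ℚ the discriminant of an unramified E of degree at most n is bounded by |d_k|ⁿ, so
  -- Hermite's theorem applies after restricting scalars.
  have hfin := finite_of_discr_bdd A ((discr k).natAbs ^ n)
  refine Set.Finite.of_finite_image (f := IntermediateField.restrictScalars ℚ)
    ((hfin.image Subtype.val).subset ?_) ((IntermediateField.restrictScalars_injective ℚ).injOn)
  rintro _ ⟨E, ⟨hE, hn, hu⟩, rfl⟩
  have hN : NumberField E := NumberField.of_module_finite k E
  have hQ : FiniteDimensional ℚ E := inferInstance
  have hQ' : FiniteDimensional ℚ (IntermediateField.restrictScalars ℚ E) := hQ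
  have hN' : NumberField (IntermediateField.restrictScalars ℚ E) := ⟨⟩
  refine ⟨⟨IntermediateField.restrictScalars ℚ E, hQ'⟩, ?_, rfl⟩
  have h₁ : discr (IntermediateField.restrictScalars ℚ E) = discr E :=
    discr_eq_discr_of_ringEquiv _ (RingEquiv.refl E)
  change |discr (IntermediateField.restrictScalars ℚ E)| ≤ _
  rw [h₁, Int.abs_eq_natAbs, natAbs_discr_of_isUnramifiedAtPrimes hu]
  exact_mod_cast Nat.pow_le_pow_right (Int.natAbs_pos.2 (discr_ne_zero k)) hn

end Unramified

/-! ### Finiteness of H¹ of the tower group. -/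

section Finiteness

variable (p : ℕ) [Fact p.Prime] (k : Type*) [Field k] [NumberField k]

/-- The kernel of an additive character. -/
def contHom.ker {p : ℕ} {Γ : Type*} [Group Γ] [TopologicalSpace Γ] (χ : contHom p Γ) :
    Subgroup Γ :=
  (MonoidHom.mk' (fun g ↦ Multiplicative.ofAdd (χ.1 g)) fun g h ↦
    congrArg Multiplicative.ofAdd (χ.2.2 g h)).ker

theorem contHom.mem_ker {p : ℕ} {Γ : Type*} [Group Γ] [TopologicalSpace Γ] {χ : contHom p Γ}
    {g : Γ} : g ∈ contHom.ker χ ↔ χ.1 g = 0 := Iff.rfl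

theorem contHom.index_ker {Γ : Type*} [Group Γ] [TopologicalSpace Γ] (χ : contHom p Γ) :
    (contHom.ker χ).index ≠ 0 ∧ (contHom.ker χ).index ≤ p := by
  rw [contHom.ker, Subgroup.index_ker]
  refine ⟨Nat.card_pos.ne', ?_⟩
  calc _ ≤ Nat.card (Multiplicative (ZMod p)) := Subgroup.card_le_card_group _
    _ = p := Nat.card_zmod p

theorem contHom.isClosed_ker {Γ : Type*} [Group Γ] [TopologicalSpace Γ] (χ : contHom p Γ) :
    IsClosed (contHom.ker χ : Set Γ) :=
  (isClosed_discrete {0}).preimage χ.2.1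

/-- A group all of whose characters have one of finitely many kernels has finitely many
characters. -/
theorem contHom.finite_of_finite_range_ker {Γ : Type*} [Group Γ] [TopologicalSpace Γ]
    (h : (Set.range (contHom.ker (p := p) (Γ := Γ))).Finite) : Finite (contHom p Γ) := by
  have := h.to_subtype
  let H : Subgroup Γ := ⨅ K : Set.range (contHom.ker (p := p) (Γ := Γ)), K.1
  have (K : Set.range (contHom.ker (p := p) (Γ := Γ))) : K.1.FiniteIndex := by
    obtain ⟨_, χ, rfl⟩ := K
    exact ⟨(contHom.index_ker p χ).1⟩
  have hH : H.FiniteIndex := Subgroup.finiteIndex_iInf inferInstance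
  have hle (χ : contHom p Γ) {g : Γ} (hg : g ∈ H) : χ.1 g = 0 :=
    contHom.mem_ker.1 ((iInf_le (fun K : Set.range (contHom.ker (p := p) (Γ := Γ)) ↦ K.1)
      ⟨_, χ, rfl⟩ : H ≤ contHom.ker χ) hg)
  -- H is the intersection of finitely many kernels of finite index, and every character factors
  -- through the finite coset space Γ/H.
  refine Finite.of_injective (fun χ (q : Γ ⧸ H) ↦ χ.1 q.out) fun χ ψ h ↦
    Subtype.ext (funext fun g ↦ ?_)
  have key (χ : contHom p Γ) : χ.1 g = χ.1 (g : Γ ⧸ H).out := by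
    have h₁ := hle χ (QuotientGroup.eq.1 (QuotientGroup.out_eq' (g : Γ ⧸ H)))
    have h₂ := χ.2.2 (g : Γ ⧸ H).out ((g : Γ ⧸ H).out⁻¹ * g)
    rw [mul_inv_cancel_left] at h₂
    rw [h₂, h₁, add_zero]
  rw [key χ, key ψ]
  exact congrFun h g

/-- There are only finitely many unramified cyclic extensions of degree `p`. -/
theorem finite_contHom_towerGroup : Finite (contHom p (towerGroup p k)) := by
  refine contHom.finite_of_finite_range_ker p ?_
  have hfin := finite_isUnramifiedAtPrimes k (AlgebraicClosure k) p
  have hfix (χ : contHom p (towerGroup p k)) :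
      (IntermediateField.fixedField (contHom.ker χ)).fixingSubgroup = contHom.ker χ :=
    InfiniteGalois.fixingSubgroup_fixedField ⟨contHom.ker χ, contHom.isClosed_ker p χ⟩
  -- By the infinite Galois correspondence a kernel is recovered from its fixed field, which is
  -- unramified of degree at most p over k. Hence only finitely many kernels occur.
  refine (hfin.image fun E ↦ (IntermediateField.comap
    (hilbertTower p k).val E).fixingSubgroup).subset ?_
  rintro _ ⟨χ, rfl⟩
  let F := IntermediateField.fixedField (contHom.ker χ)
  have hidx : Module.finrank k F = (contHom.ker χ).index := by
    rw [IntermediateField.finrank_eq_fixingSubgroup_index, hfix]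
  have hF : FiniteDimensional k F :=
    FiniteDimensional.of_finrank_pos (hidx ▸ Nat.pos_of_ne_zero (contHom.index_ker p χ).1)
  let e := IntermediateField.liftAlgEquiv F
  have hE : FiniteDimensional k (IntermediateField.lift F) := e.toLinearEquiv.finiteDimensional
  refine ⟨IntermediateField.lift F, ⟨hE, ?_, ?_⟩, ?_⟩
  · rw [← e.toLinearEquiv.finrank_eq, hidx]
    exact (contHom.index_ker p χ).2
  · exact isUnramifiedAtPrimes_of_le_hilbertTower p _ (IntermediateField.lift_le F)
  · have h : IntermediateField.comap (hilbertTower p k).val (IntermediateField.lift F) = F :=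
      IntermediateField.ext fun x ↦ IntermediateField.mem_lift x
    exact (congrArg _ h).trans (hfix χ)

instance : Module.Finite (ZMod p) (contHom p (towerGroup p k)) :=
  have := finite_contHom_towerGroup p k
  Module.Finite.of_finite

end Finiteness

/-! ### Infinite places and roots of unity in degree p. -/

section Degree

variable {p : ℕ} [hp : Fact p.Prime] {k k' : Type*} [Field k] [NumberField k] [Field k']
  [NumberField k'] [Algebra k k']

theorem nrPlaces_mul_finrank [IsGalois k k'] [IsUnramifiedAtInfinitePlaces k k'] :
    InfinitePlace.nrRealPlaces k' + InfinitePlace.nrComplexPlaces k' =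
      (InfinitePlace.nrRealPlaces k + InfinitePlace.nrComplexPlaces k) * Module.finrank k k' := by
  rw [← InfinitePlace.card_eq_nrRealPlaces_add_nrComplexPlaces,
    ← InfinitePlace.card_eq_nrRealPlaces_add_nrComplexPlaces,
    IsUnramifiedAtInfinitePlaces.card_infinitePlace k]

theorem containsMu_iff_of_finrank_eq (h : Module.finrank k k' = p) :
    ContainsMu p k' ↔ ContainsMu p k := by
  refine ⟨fun ⟨ζ, hζ⟩ ↦ ?_, fun ⟨ζ, hζ⟩ ↦ ⟨_, hζ.map_of_injective (algebraMap k k').injective⟩⟩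
  have hint : IsIntegral k ζ := Algebra.IsIntegral.isIntegral ζ
  have hdvd : (minpoly k ζ).natDegree ∣ p := h ▸ minpoly.degree_dvd hint
  have hle : (minpoly k ζ).natDegree ≤ p - 1 := by
    have h₁ : minpoly k ζ ∣ Polynomial.cyclotomic p k := minpoly.dvd _ _ (by
      rw [← Polynomial.eval_map_algebraMap, Polynomial.map_cyclotomic]
      exact hζ.isRoot_cyclotomic hp.out.pos)
    have h₂ := Polynomial.natDegree_le_of_dvd h₁ (Polynomial.cyclotomic_ne_zero p k)
    rwa [Polynomial.natDegree_cyclotomic, Nat.totient_prime hp.out] at h₂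
  have hone : (minpoly k ζ).natDegree = 1 := by
    rcases (Nat.dvd_prime hp.out).1 hdvd with h₁ | h₁
    · exact h₁
    · have := hp.out.pos
      lia
  obtain ⟨x, rfl⟩ := minpoly.natDegree_eq_one_iff.1 hone
  exact ⟨x, IsPrimitiveRoot.of_map_of_injective hζ (algebraMap k k').injective⟩

end Degree

/-! ### The inequality. -/

theorem mainTheorem6 (p : ℕ) [Fact p.Prime]
    (k k' : Type*) [Field k] [NumberField k] [Field k'] [NumberField k'] [Algebra k k']
    [IsGalois k k'] (hcyc : Nonempty (Gal(k'/k) ≃* Multiplicative (ZMod p)))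
    (htame : IsTamelyRamifiedExt k k')
    (S : GroupExtension (Multiplicative (ZMod p)) (towerGroup p k') (towerGroup p k))
    (hS : Continuous S.rightHom)
    (hf : fInv p k ≥ 2 * cohDim p 1 (towerGroup p k) + 3) :
    fInv p k' ≥ 2 * cohDim p 1 (towerGroup p k') + 3 := by
  obtain ⟨e⟩ := hcyc
  have hdeg : Module.finrank k k' = p := by
    rw [← IsGalois.card_aut_eq_finrank, Nat.card_congr e.toEquiv]
    exact Nat.card_zmod p
  have := htame.2
  have hplaces := nrPlaces_mul_finrank (k := k) (k' := k')
  obtain ⟨t, H⟩ := S.exists_isCentralZModExtension (isTopologicallyPTorsion_towerGroup p k') hS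
  have h₁ := H.finrank_contHom_le
  have h₂ := H.finrank_contH₂_le
  rw [← cohDim_one_eq, ← cohDim_one_eq] at h₁
  rw [← cohDim_one_eq, ← cohDim_two_eq, ← cohDim_two_eq] at h₂
  have hr : 2 * (InfinitePlace.nrRealPlaces k + InfinitePlace.nrComplexPlaces k) ≤
      InfinitePlace.nrRealPlaces k' + InfinitePlace.nrComplexPlaces k' := by
    rw [hplaces, hdeg, mul_comm]
    exact Nat.mul_le_mul_left _ (Fact.out : p.Prime).two_le
  have hμ := containsMu_iff_of_finrank_eq (k := k) (k' := k') hdeg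
  unfold fInv at hf ⊢
  by_cases h : ContainsMu p k
  · rw [if_pos h] at hf
    rw [if_pos (hμ.2 h)]
    lia
  -- Here r ≥ h² + h¹ + 4, and the goal is r' ≥ h²(G') + h¹(G') + 4. The right side is at most h² +
  -- 2h¹ + 6, below 2r.
  · rw [if_neg h] at hf
    rw [if_neg (mt hμ.1 h)]
    lia
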